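/- Let $q$ be a prime power, $A=\mathbb{F}_q[T]$, $k=\mathbb{F}_q(T)$, and let $k^{\mathrm{alg}}$ be an algebraic closure of $k$. Let $\tau$ be the $q$-power map $x\mapsto x^q$, and let $a\mapsto C_a$ be the Carlitz module, i.e. the $\mathbb{F}_q$-algebra homomorphism from $A$ to the twisted polynomial ring $k\langle\tau\rangle$ with $C_T=T+\tau$; write $C_a(x)\in A[x]$ for the polynomial obtained by letting $C_a$ act on a variable $x$ (so $C_T(x)=Tx+x^q$ and $C_{ab}(x)=C_a(C_b(x))$). Let $\wp\in A$ be a monic prime, and assume that $q>2$ or $\deg\wp>1$. Let $\Lambda_\wp=\{\lambda\in k^{\mathrm{alg}} : C_\wp(\lambda)=0\}$, an $A$-module via $a\cdot\lambda=C_a(\lambda)$, and let $\lambda_\wp\in\Lambda_\wp$ be a generator of this $A$-module. Let $\mathbb{K}_\wp=k(\Lambda_\wp)$ and let $\mathcal{O}_\wp$ be the integral closure of $A$ in $\mathbb{K}_\wp$. Let $g\in A$ be a primitive root modulo $\wp$, i.e. the class of $g$ generates the group $(A/\wp A)^\times$. Let $\epsilon$ be a unit of $\mathcal{O}_\wp$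 with $\mathrm{Norm}_{\mathbb{K}_\wp/k}(\epsilon)=1$. Then there exist an integer $\ell$ with $0\le\ell\le q^{\deg\wp}-2$ and a polynomial $Q(x)\in A[x]$ of degree at most $q^{\deg\wp}-2$, with $Q(\lambda_\wp)$ a unit of $\mathcal{O}_\wp$, such that $$\epsilon=\left(\frac{\lambda_\wp}{C_g(\lambda_\wp)}\right)^{\ell}\cdot\frac{Q(\lambda_\wp)}{Q(C_g(\lambda_\wp))}.$$ Moreover this representation is unique up to scaling $Q$ by a nonzero constant: if $\ell_\star$ is an integer with $0\le\ell_\star\le q^{\deg\wp}-2$ and $Q_\star(x)\in A[x]$ has degree at most $q^{\deg\wp}-2$, with $Q_\star(\lambda_\wp)$ a unit of $\mathcal{O}_\wp$, and $$\epsilon=\left(\frac{\lambda_\wp}{C_g(\lambda_\wp)}\right)^{\ell_\star}\cdot\frac{Q_\star(\lambda_\wp)}{Q_\star(C_g(\lambda_\wp))},$$ then $\ell_\star=\ell$ and $Q_\star=\upsilon Q$ for some $\upsilon\in\mathbb{F}_q^\times$. -/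

import Mathlib

open Polynomial

noncomputable section

/-- The operator `C_T = T + τ`, where `τ(f) = f ^ q`, on the polynomial ring `A[x]`, with
`A = 𝔽_q[T]`. -/
def carlitzT (F : Type*) [Field F] [Fintype F] : Module.End F F[X][X] :=
  LinearMap.mulLeft F (C X : F[X][X]) + (FiniteField.frobeniusAlgHom F F[X][X]).toLinearMap

/-- The Carlitz module: the `𝔽_q`-algebra homomorphism `a ↦ C_a` on `A = 𝔽_q[T]` with
`C_T = T + τ`. A twisted polynomial `∑ aᵢ τ ^ i` is represented by the operator
`f ↦ ∑ aᵢ f ^ (q ^ i)` on `A[x]`, so that the product of twisted polynomials is the composition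
of operators. -/
def carlitzModule (F : Type*) [Field F] [Fintype F] : F[X] →ₐ[F] Module.End F F[X][X] :=
  aeval (carlitzT F)

/-- The polynomial `C_a(x) ∈ A[x]`. -/
def carlitzPoly {F : Type*} [Field F] [Fintype F] (a : F[X]) : F[X][X] :=
  carlitzModule F a X

theorem carlitzPoly_T {F : Type*} [Field F] [Fintype F] :
    carlitzPoly (X : F[X]) = C X * X + X ^ Fintype.card F := by
  simp [carlitzPoly, carlitzModule, carlitzT]

theorem carlitzPoly_const {F : Type*} [Field F] [Fintype F] (c : F) :
    carlitzPoly (C c : F[X]) = C (C c) * X := by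
  simp [carlitzPoly, carlitzModule, Module.algebraMap_end_apply,
    Algebra.smul_def, Polynomial.algebraMap_apply]

theorem carlitzPoly_add {F : Type*} [Field F] [Fintype F] (a b : F[X]) :
    carlitzPoly (a + b) = carlitzPoly a + carlitzPoly b := by
  simp [carlitzPoly]

theorem carlitzModule_apply {F : Type*} [Field F] [Fintype F] (a : F[X]) (f : F[X][X]) :
    carlitzModule F a f = (carlitzPoly a).comp f := by
  have hT : ∀ h : F[X][X], (carlitzT F h).comp f = carlitzT F (h.comp f) := by
    intro h
    simp [carlitzT]
  have key : ∀ h : F[X][X], (carlitzModule F a h).comp f = carlitzModule F a (h.comp f) := by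
    induction a using Polynomial.induction_on with
    | C c =>
      intro h
      simp [carlitzModule, Module.algebraMap_end_apply, Algebra.smul_def,
        Polynomial.algebraMap_apply]
    | add p q hp hq =>
      intro h
      simp [map_add, hp, hq]
    | monomial n c ih =>
      intro h
      rw [pow_succ, ← mul_assoc, map_mul, Module.End.mul_apply, ih, Module.End.mul_apply]
      congr 1
      simpa [carlitzModule] using hT h
  simpa [carlitzPoly] using (key X).symm

theorem carlitzPoly_mul {F : Type*} [Field F] [Fintype F] (a b : F[X]) :
    carlitzPoly (a * b) = (carlitzPoly a).comp (carlitzPoly b) := by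
  rw [← carlitzModule_apply]
  simp [carlitzPoly]

/-- The torsion `Λ_m = {x ∈ Ω | C_m(x) = 0}` of the Carlitz module. -/
def carlitzTorsion {F : Type*} [Field F] [Fintype F] (m : F[X])
    (Ω : Type*) [Field Ω] [Algebra F[X] Ω] : Set Ω :=
  {x | aeval x (carlitzPoly m) = 0}

/-- `x` is a primitive `m`-th root of the Carlitz module: it lies in `Λ_m` and generates `Λ_m` as
an `A`-module, where `a ∈ A` acts by `y ↦ C_a(y)`. -/
def IsPrimitiveCarlitzRoot {F : Type*} [Field F] [Fintype F] (m : F[X])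
    {Ω : Type*} [Field Ω] [Algebra F[X] Ω] (x : Ω) : Prop :=
  x ∈ carlitzTorsion m Ω ∧
    ∀ y ∈ carlitzTorsion m Ω, ∃ a : F[X], y = aeval x (carlitzPoly a)

/-- The `m`-th cyclotomic function field `k(Λ_m)`, with `k = 𝔽_q(T)`, inside `Ω`. -/
abbrev CyclotomicFunctionField {F : Type*} [Field F] [Fintype F] (m : F[X])
    (Ω : Type*) [Field Ω] [Algebra F[X] Ω] [Algebra (RatFunc F) Ω] :
    IntermediateField (RatFunc F) Ω :=
  IntermediateField.adjoin (RatFunc F) (carlitzTorsion m Ω)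

/-- The ring of integers of the `m`-th cyclotomic function field: the integral closure of
`A = 𝔽_q[T]` in it. -/
abbrev CyclotomicIntegers {F : Type*} [Field F] [Fintype F] (m : F[X])
    (Ω : Type*) [Field Ω] [Algebra F[X] Ω] [Algebra (RatFunc F) Ω]
    [IsScalarTower F[X] (RatFunc F) Ω] :
    Subalgebra F[X] (CyclotomicFunctionField m Ω) :=
  integralClosure F[X] (CyclotomicFunctionField m Ω)

/-- `x ∈ Ω` is (the image of) a unit of the ring of integers of the `m`-th cyclotomic function
field. -/
def IsCyclotomicUnit {F : Type*} [Field F] [Fintype F] (m : F[X])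
    {Ω : Type*} [Field Ω] [Algebra F[X] Ω] [Algebra (RatFunc F) Ω]
    [IsScalarTower F[X] (RatFunc F) Ω] (x : Ω) : Prop :=
  ∃ u : (CyclotomicIntegers m Ω)ˣ,
    (((u : CyclotomicIntegers m Ω) : CyclotomicFunctionField m Ω) : Ω) = x

/-- `g` is a primitive root modulo `m`: its class is a unit that generates `(A/mA)ˣ`. -/
def IsPrimitiveRootModulo {F : Type*} [Field F] (m g : F[X]) : Prop :=
  ∃ u : (F[X] ⧸ Ideal.span {m})ˣ,
    (u : F[X] ⧸ Ideal.span {m}) = Ideal.Quotient.mk (Ideal.span {m}) g ∧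
      ∀ v : (F[X] ⧸ Ideal.span {m})ˣ, v ∈ Subgroup.zpowers u

/-- The pair `(ℓ, Q)` represents `ε`: `0 ≤ ℓ ≤ q ^ deg P - 2`, `Q ∈ A[x]` has degree at most
`q ^ deg P - 2`, `Q(x)` is a unit of the ring of integers of the `P`-th cyclotomic function field,
and `ε = (x / C_g(x)) ^ ℓ * (Q(x) / Q(C_g(x)))`. -/
def IsUnitRepresentation {F : Type*} [Field F] [Fintype F] (P g : F[X])
    {Ω : Type*} [Field Ω] [Algebra F[X] Ω] [Algebra (RatFunc F) Ω]
    [IsScalarTower F[X] (RatFunc F) Ω] (x ε : Ω) (l : ℕ) (Q : F[X][X]) : Prop :=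
  l ≤ Fintype.card F ^ P.natDegree - 2 ∧
    Q.natDegree ≤ Fintype.card F ^ P.natDegree - 2 ∧
    IsCyclotomicUnit P (aeval x Q) ∧
    ε = (x / aeval x (carlitzPoly g)) ^ l *
      (aeval x Q / aeval (aeval x (carlitzPoly g)) Q)

end

/-!
Why the theorem holds. Let `A = 𝔽_q[T]`, `n = q ^ deg P - 1`, `K = k(Λ_P)` and let `𝒪` be the
integral closure of `A` in `K`.

The polynomial `Φ(x) = C_P(x) / x` is monic of degree `n` with constant term `P`, it is Eisenstein
at `P` (`isEisensteinAt_carlitzEisenstein`), and `x Φ(x) = C_P(x)` has the constant derivative `P`.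
Hence `K = k(λ)` is a Galois extension of degree `n`, totally ramified at `P`, and the discriminant
of `1, λ, …, λ ^ (n - 1)` is, up to sign, a power of `P`, so that `𝒪 = A[λ]`
(`IsEisensteinGenerator.exists_aeval_eq`). The Galois group is generated by `σ : λ ↦ C_g(λ)`
(`IsPrimitiveCarlitzRoot.exists_galois_generator`).

By Hilbert's Theorem 90 a unit `ε` of norm one is `y / σ y`, and every conjugate of `y` is `y` times
a unit. Scaling `y` into `𝒪`, this makes `y ^ n` a unit times the norm `c ∈ A` of `y`. A prime
`r ≠ P` of `A` generates a radical ideal of `𝒪`, because `Φ` is squarefree modulo `r`, and so does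
`λ`; therefore the prime factors of `c` can be split off from `y` one by one, and
`y = a λ ^ j u` with `a ∈ k` and a unit `u` (`IsEisensteinGenerator.exists_eq_mul_pow_mul`). Since
`λ ^ n` is a unit times `P`, the exponent may be reduced modulo `n`. Dividing by the conjugate
cancels `a` and leaves `ε = (λ / σ λ) ^ l * (u / σ u)`, where `u = Q(λ)` with `deg Q < n`.

For uniqueness, two representations give an element `λ ^ (l' - l) Q'(λ) / Q(λ)` fixed by `σ`, hence
in `k`. As `P` is totally ramified of index `n > |l' - l|`, the exponents agree
(`IsEisensteinGenerator.le_of_pow_mul_eq`); the remaining factor is a unit of `A`, and polynomials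
of degree less than `n` are determined by their value at `λ`.

The ramification argument is carried out for any principal ideal domain `A` and a generator of the
kind described by `IsEisensteinGenerator`.
-/

/-! ### Units of an integral closure -/

/-- A nonzero element which is integral over `A` together with its inverse, that is, a unit of the
integral closure of `A` in the field `L`. -/
def IsIntegralUnit (A : Type*) {L : Type*} [CommRing A] [Field L] [Algebra A L] (z : L) : Prop :=
  z ≠ 0 ∧ IsIntegral A z ∧ IsIntegral A z⁻¹

namespace IsIntegralUnit

variable {A L : Type*} [CommRing A] [Field L] [Algebra A L] {z w : L}

theorem one : IsIntegralUnit A (1 : L) :=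
  ⟨one_ne_zero, isIntegral_one, by simpa using isIntegral_one⟩

theorem mul (hz : IsIntegralUnit A z) (hw : IsIntegralUnit A w) : IsIntegralUnit A (z * w) :=
  ⟨mul_ne_zero hz.1 hw.1, hz.2.1.mul hw.2.1, by rw [mul_inv]; exact hz.2.2.mul hw.2.2⟩

theorem inv (hz : IsIntegralUnit A z) : IsIntegralUnit A z⁻¹ :=
  ⟨inv_ne_zero hz.1, hz.2.2, by rw [inv_inv]; exact hz.2.1⟩

theorem div (hz : IsIntegralUnit A z) (hw : IsIntegralUnit A w) : IsIntegralUnit A (z / w) := by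
  rw [div_eq_mul_inv]; exact hz.mul hw.inv

theorem pow (hz : IsIntegralUnit A z) (n : ℕ) : IsIntegralUnit A (z ^ n) :=
  ⟨pow_ne_zero n hz.1, hz.2.1.pow n, by rw [← inv_pow]; exact hz.2.2.pow n⟩

theorem neg (hz : IsIntegralUnit A z) : IsIntegralUnit A (-z) :=
  ⟨neg_ne_zero.2 hz.1, hz.2.1.neg, by rw [inv_neg]; exact hz.2.2.neg⟩

theorem prod {ι : Type*} {s : Finset ι} {f : ι → L} (h : ∀ i ∈ s, IsIntegralUnit A (f i)) :
    IsIntegralUnit A (∏ i ∈ s, f i) :=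
  Finset.prod_induction f (IsIntegralUnit A) (fun _ _ ↦ mul) one h

theorem of_isUnit {c : A} (hc : IsUnit c) : IsIntegralUnit A (algebraMap A L c) := by
  obtain ⟨u, rfl⟩ := hc
  have h : algebraMap A L u * algebraMap A L ↑u⁻¹ = 1 := by rw [← map_mul]; simp
  refine ⟨left_ne_zero_of_mul_eq_one h, isIntegral_algebraMap, ?_⟩
  rw [inv_eq_of_mul_eq_one_right h]
  exact isIntegral_algebraMap

theorem of_pow (hz : IsIntegral A z) {n : ℕ} (hn : n ≠ 0) (h : IsIntegralUnit A (z ^ n)) :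
    IsIntegralUnit A z := by
  have hz0 : z ≠ 0 := fun h0 ↦ h.1 (by rw [h0, zero_pow hn])
  obtain ⟨m, rfl⟩ := Nat.exists_eq_succ_of_ne_zero hn
  refine ⟨hz0, hz, ?_⟩
  have : z⁻¹ = z ^ m * (z ^ (m + 1))⁻¹ := by
    field_simp
    ring
  rw [this]
  exact (hz.pow m).mul h.2.2

theorem map {M : Type*} [Field M] [Algebra A M]
    (hz : IsIntegralUnit A z) (f : L →ₐ[A] M) : IsIntegralUnit A (f z) :=
  ⟨(map_ne_zero f).2 hz.1, hz.2.1.map f, by rw [← map_inv₀]; exact hz.2.2.map f⟩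

end IsIntegralUnit

/-! ### Hilbert's Theorem 90 for cyclic extensions -/

/-- Hilbert's Theorem 90 for a finite cyclic extension, in arbitrary universes. With `n` the order
of `σ`, the linear independence of `1, σ, …, σ ^ (n - 1)` gives `z` such that
`y = ∑ i < n, (ε * σ ε * ⋯ * σ ^ (i - 1) ε) * σ ^ i z` is nonzero, and then `ε * σ y = y`. -/
theorem exists_div_galois_eq_of_norm_eq_one {k L : Type*} [Field k] [Field L] [Algebra k L]
    [FiniteDimensional k L] [IsGalois k L] {σ : L ≃ₐ[k] L}
    (hσ : ∀ τ : L ≃ₐ[k] L, τ ∈ Subgroup.zpowers σ) {ε : L} (hε : Algebra.norm k ε = 1) :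
    ∃ y : L, y ≠ 0 ∧ y / σ y = ε := by
  classical
  set n := orderOf σ with hn
  have hn0 : 0 < n := orderOf_pos σ
  have hinj : Set.InjOn (fun i ↦ σ ^ i) (Finset.range n) := by
    simpa [Set.Iio] using pow_injOn_Iio_orderOf (x := σ)
  let b (i : ℕ) : L := ∏ j ∈ Finset.range i, (σ ^ j) ε
  have hbn : b n = 1 := by
    have h1 := Algebra.norm_eq_prod_automorphisms k ε
    rw [hε, map_one] at h1
    rw [h1]
    refine Finset.prod_nbij (fun i ↦ σ ^ i) (by simp) hinj ?_ (fun _ _ ↦ rfl)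
    intro τ _
    obtain ⟨i, hi, hiτ⟩ := Finset.mem_image.1 (mem_zpowers_iff_mem_range_orderOf.1 (hσ τ))
    exact ⟨i, hi, hiτ⟩
  have hb (i : ℕ) : b (i + 1) = ε * σ (b i) := by
    simp only [b]
    rw [Finset.prod_range_succ', map_prod, mul_comm]
    simp [pow_succ']
  obtain ⟨z, hz⟩ : ∃ z, ∑ i ∈ Finset.range n, b i * (σ ^ i) z ≠ 0 := by
    by_contra! H
    have hli : LinearIndependent L
        (fun i : Fin n ↦ (((σ ^ (i : ℕ) : L ≃ₐ[k] L) : L →* L) : L → L)) := by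
      refine (linearIndependent_monoidHom L L).comp
        (fun i : Fin n ↦ ((σ ^ (i : ℕ) : L ≃ₐ[k] L) : L →* L)) fun i j hij ↦ ?_
      refine Fin.ext (hinj (by simp) (by simp) (AlgEquiv.ext fun z ↦ ?_))
      exact DFunLike.congr_fun hij z
    have := Fintype.linearIndependent_iff.1 hli (fun i ↦ b i) (funext fun z ↦ by
      have := H z
      rw [Finset.sum_range] at this
      simpa using this) ⟨0, hn0⟩
    simp [b] at this
  refine ⟨_, hz, ?_⟩
  rw [div_eq_iff ((map_ne_zero σ).2 hz), map_sum, Finset.mul_sum]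
  have hstep (i : ℕ) : ε * σ (b i * (σ ^ i) z) = b (i + 1) * (σ ^ (i + 1)) z := by
    rw [hb, map_mul, pow_succ' σ i, AlgEquiv.mul_apply, mul_assoc]
  simp only [hstep]
  have := (Finset.sum_range_succ (fun i ↦ b i * (σ ^ i) z) n).symm.trans
    (Finset.sum_range_succ' (fun i ↦ b i * (σ ^ i) z) n)
  rw [hbn, hn, pow_orderOf_eq_one] at this
  simpa [b] using this

/-! ### Totally ramified generators -/

/-- The data of a totally ramified generator: `x` generates `L` over `k`, and it is a root of the
monic polynomial `Φ` over `A`, which is Eisenstein at the prime `p` with constant term `p` and such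
that `X * Φ` has the constant derivative `p`. -/
structure IsEisensteinGenerator {A L : Type*} (k : Type*) [CommRing A] [Field k] [Field L]
    [Algebra A L] [Algebra k L] (p : A) (Φ : A[X]) (x : L) : Prop where
  prime : Prime p
  monic : Φ.Monic
  eisenstein : Φ.IsEisensteinAt (Ideal.span {p})
  coeff_zero : Φ.coeff 0 = p
  derivative_X_mul : derivative (X * Φ) = C p
  aeval_eq_zero : aeval x Φ = 0
  adjoin_eq_top : Algebra.adjoin k {x} = ⊤

namespace IsEisensteinGenerator

section

variable {A k L : Type*} [CommRing A] [Field k] [Field L] [Algebra A L] [Algebra k L]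
  {p : A} {Φ : A[X]} {x : L}

theorem isIntegral (h : IsEisensteinGenerator k p Φ x) : IsIntegral A x :=
  ⟨Φ, h.monic, by rw [← aeval_def]; exact h.aeval_eq_zero⟩

theorem natDegree_pos (h : IsEisensteinGenerator k p Φ x) : 0 < Φ.natDegree := by
  by_contra h0
  have h1 := h.monic.natDegree_eq_zero.1 (by omega)
  have := h.aeval_eq_zero
  simp [h1] at this

theorem isIntegral_aeval (h : IsEisensteinGenerator k p Φ x) (f : A[X]) :
    IsIntegral A (aeval x f) :=
  adjoin_le_integralClosure h.isIntegral (aeval_mem_adjoin_singleton A x)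

theorem aeval_derivative_mul (h : IsEisensteinGenerator k p Φ x) :
    aeval x (derivative Φ) * x = algebraMap A L p := by
  have := congrArg (aeval x) h.derivative_X_mul
  simp only [derivative_mul, derivative_X, one_mul, map_add, map_mul, aeval_X, aeval_C,
    h.aeval_eq_zero, zero_add] at this
  rw [mul_comm, this]

theorem exists_algebraMap_prime_eq (h : IsEisensteinGenerator k p Φ x) :
    ∃ w, IsIntegral A w ∧ algebraMap A L p = x * w := by
  refine ⟨_, h.isIntegral_aeval (derivative Φ), ?_⟩
  rw [← h.aeval_derivative_mul, mul_comm]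

/-- Modulo `p`, an Eisenstein polynomial is a power of the variable. -/
theorem exists_eq_X_pow_add (h : IsEisensteinGenerator k p Φ x) :
    ∃ e : A[X], Φ = X ^ Φ.natDegree + C p * e := by
  obtain ⟨e, he⟩ : C p ∣ Φ - X ^ Φ.natDegree := by
    rw [C_dvd_iff_dvd_coeff]
    intro i
    rw [coeff_sub, coeff_X_pow]
    rcases lt_trichotomy i Φ.natDegree with hi | rfl | hi
    · simpa [hi.ne] using Ideal.mem_span_singleton.1 (h.eisenstein.mem hi)
    · simp [h.monic.coeff_natDegree]
    · simp [hi.ne', coeff_eq_zero_of_natDegree_lt hi]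
  exact ⟨e, by rw [← he]; ring⟩

theorem irreducible [IsDomain A] (h : IsEisensteinGenerator k p Φ x) : Irreducible Φ :=
  h.eisenstein.irreducible ((Ideal.span_singleton_prime h.prime.ne_zero).2 h.prime)
    h.monic.isPrimitive h.natDegree_pos

variable [Algebra A k] [IsScalarTower A k L]

/-- The power basis of `L` over `k` given by the powers of `x`. -/
noncomputable def powerBasis (h : IsEisensteinGenerator k p Φ x) : PowerBasis k L :=
  .ofAdjoinEqTop (h.isIntegral.tower_top) h.adjoin_eq_top

theorem powerBasis_gen (h : IsEisensteinGenerator k p Φ x) : h.powerBasis.gen = x := rfl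

theorem ne_zero [IsFractionRing A k] (h : IsEisensteinGenerator k p Φ x) : x ≠ 0 := by
  have : FaithfulSMul A L := .trans A k L
  rintro rfl
  have h0 := h.aeval_eq_zero
  rw [aeval_def, eval₂_at_zero, h.coeff_zero,
    map_eq_zero_iff _ (FaithfulSMul.algebraMap_injective A L)] at h0
  exact h.prime.ne_zero h0

end

variable {A k L : Type*} [CommRing A] [IsDomain A] [IsPrincipalIdealRing A] [Field k] [Field L]
  [Algebra A k] [IsFractionRing A k] [Algebra A L] [Algebra k L] [IsScalarTower A k L]
  {p : A} {Φ : A[X]} {x : L}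

theorem minpoly_fractionRing (h : IsEisensteinGenerator k p Φ x) :
    minpoly k x = Φ.map (algebraMap A k) := by
  symm
  refine minpoly.eq_of_irreducible_of_monic ?_ ?_ (h.monic.map _)
  · exact (h.monic.irreducible_iff_irreducible_map_fraction_map (K := k)).1 h.irreducible
  · rw [aeval_map_algebraMap, h.aeval_eq_zero]

theorem minpoly_eq (h : IsEisensteinGenerator k p Φ x) : minpoly A x = Φ := by
  have : FaithfulSMul A L := .trans A k L
  apply map_injective _ (IsFractionRing.injective A k)
  rw [← h.minpoly_fractionRing, minpoly.isIntegrallyClosed_eq_field_fractions' k h.isIntegral]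

theorem aeval_eq_zero_iff (h : IsEisensteinGenerator k p Φ x) (f : A[X]) :
    aeval x f = 0 ↔ Φ ∣ f := by
  have : FaithfulSMul A L := .trans A k L
  rw [minpoly.isIntegrallyClosed_dvd_iff h.isIntegral, h.minpoly_eq]

theorem norm_eq (h : IsEisensteinGenerator k p Φ x) :
    Algebra.norm k x = (-1) ^ Φ.natDegree * algebraMap A k p := by
  have := Algebra.PowerBasis.norm_gen_eq_coeff_zero_minpoly h.powerBasis
  rw [h.powerBasis_gen, h.minpoly_fractionRing, coeff_map, h.coeff_zero] at this
  rw [this, ← h.powerBasis.natDegree_minpoly, h.powerBasis_gen, h.minpoly_fractionRing,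
    h.monic.natDegree_map]

theorem finrank_eq (h : IsEisensteinGenerator k p Φ x) : Module.finrank k L = Φ.natDegree := by
  rw [h.powerBasis.finrank, ← h.powerBasis.natDegree_minpoly, h.powerBasis_gen,
    h.minpoly_fractionRing, h.monic.natDegree_map]

/-- Every integral element is a polynomial in `x`: the discriminant of the powers of `x` is, up to
sign, a power of `p`, and an Eisenstein generator is maximal at `p`. -/
theorem exists_aeval_eq [Algebra.IsSeparable k L] (h : IsEisensteinGenerator k p Φ x) {z : L}
    (hz : IsIntegral A z) : ∃ f : A[X], aeval x f = z := by
  have hfin : FiniteDimensional k L := h.powerBasis.finite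
  suffices hmem : z ∈ Algebra.adjoin A {h.powerBasis.gen} by
    rw [h.powerBasis_gen, Algebra.adjoin_singleton_eq_range_aeval] at hmem
    exact hmem
  have hint : IsIntegral A h.powerBasis.gen := h.isIntegral
  have hdiscr := Algebra.discr_mul_isIntegral_mem_adjoin k hint hz
  set n := Φ.natDegree
  refine mem_adjoin_of_smul_prime_pow_smul_of_minpoly_isEisensteinAt (K := k) (n := n)
    h.prime hint hz ?_ (by rw [h.powerBasis_gen, h.minpoly_eq]; exact h.eisenstein)
  -- The norm of `Φ'(x) * x = p` shows that `p ^ n` is, up to sign, `p` times the discriminant.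
  have hnorm : Algebra.norm k (aeval x (derivative Φ)) * Algebra.norm k x
      = algebraMap A k p ^ n := by
    rw [← map_mul, h.aeval_derivative_mul, IsScalarTower.algebraMap_apply A k L,
      Algebra.norm_algebraMap, h.finrank_eq]
  have hd := Algebra.discr_powerBasis_eq_norm k h.powerBasis
  rw [h.powerBasis_gen, h.minpoly_fractionRing, derivative_map, aeval_map_algebraMap] at hd
  obtain ⟨s, hs⟩ : ∃ s : A, algebraMap A k p ^ n
      = algebraMap A k s * Algebra.discr k h.powerBasis.basis := by
    refine ⟨(-1) ^ (Module.finrank k L * (Module.finrank k L - 1) / 2) * (-1) ^ n * p, ?_⟩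
    have h1 : ((-1 : k) ^ (Module.finrank k L * (Module.finrank k L - 1) / 2)) ^ 2 = 1 := by
      rw [← pow_mul, mul_comm, pow_mul]; simp
    rw [hd, ← hnorm, h.norm_eq, map_mul, map_mul, map_pow, map_pow, map_neg, map_one]
    generalize (-1 : k) ^ (Module.finrank k L * (Module.finrank k L - 1) / 2) = e at h1
    linear_combination (-(aeval x (derivative Φ) |> Algebra.norm k) * (-1) ^ n *
      algebraMap A k p) * h1
  have : p ^ n • z = s • (Algebra.discr k h.powerBasis.basis • z) := by
    rw [← algebraMap_smul k (p ^ n), map_pow, hs, mul_smul, algebraMap_smul]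
  rw [this]
  exact Subalgebra.smul_mem _ hdiscr s

/-- If `r` is a prime not dividing `p`, then `r` generates a radical ideal of the ring of integers,
since `Φ` stays squarefree modulo `r`. -/
theorem exists_eq_mul_of_pow_eq_mul [Algebra.IsSeparable k L] (h : IsEisensteinGenerator k p Φ x)
    {r : A} (hr : Prime r) (hrp : ¬ r ∣ p) {z w : L} (hz : IsIntegral A z) (hw : IsIntegral A w)
    {m : ℕ} (hm : m ≠ 0) (hzw : z ^ m = algebraMap A L r * w) :
    ∃ w', IsIntegral A w' ∧ z = algebraMap A L r * w' := by
  obtain ⟨f, rfl⟩ := h.exists_aeval_eq hz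
  obtain ⟨e, rfl⟩ := h.exists_aeval_eq hw
  obtain ⟨c, hc⟩ := (h.aeval_eq_zero_iff (f ^ m - C r * e)).1 (by simp [hzw])
  have hmax : (Ideal.span {r}).IsMaximal :=
    PrincipalIdealRing.isMaximal_of_irreducible hr.irreducible
  let := Ideal.Quotient.field (Ideal.span {r})
  set φ := Ideal.Quotient.mk (Ideal.span {r})
  have hφr : φ r = 0 := Ideal.Quotient.eq_zero_iff_mem.2 (Ideal.mem_span_singleton_self r)
  have hφp : φ p ≠ 0 := fun h0 ↦
    hrp (Ideal.mem_span_singleton.1 (Ideal.Quotient.eq_zero_iff_mem.1 h0))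
  have hsq : Squarefree (Φ.map φ) := by
    have hsep : (X * Φ.map φ).Separable := by
      have hd : derivative (X * Φ.map φ) = C (φ p) := by
        rw [← map_X φ, ← Polynomial.map_mul, derivative_map, h.derivative_X_mul, map_C]
      rw [Polynomial.separable_def, hd]
      exact ⟨0, C (φ p)⁻¹, by rw [zero_mul, zero_add, ← C_mul, inv_mul_cancel₀ hφp, C_1]⟩
    exact hsep.of_mul_right.squarefree
  have hdvd : Φ.map φ ∣ f.map φ ^ m := by
    refine ⟨c.map φ, ?_⟩
    have := congrArg (Polynomial.map φ) hc
    simpa [hφr] using this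
  obtain ⟨g, hg⟩ := (hsq.dvd_pow_iff_dvd hm).1 hdvd
  obtain ⟨g, rfl⟩ := map_surjective φ Ideal.Quotient.mk_surjective g
  obtain ⟨b, hb⟩ : C r ∣ f - Φ * g := by
    rw [C_dvd_iff_dvd_coeff]
    intro i
    rw [← Ideal.mem_span_singleton, ← Ideal.Quotient.eq_zero_iff_mem]
    change φ _ = 0
    rw [← coeff_map, Polynomial.map_sub, Polynomial.map_mul, hg, sub_self, Polynomial.coeff_zero]
  refine ⟨aeval x b, h.isIntegral_aeval b, ?_⟩
  have := congrArg (aeval x) hb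
  simpa [h.aeval_eq_zero] using this

/-- The element `x` generates a radical ideal of the ring of integers: modulo `x`, every integral
element is congruent to an element of `A`. -/
theorem exists_eq_gen_mul_of_pow_eq_mul [Algebra.IsSeparable k L]
    (h : IsEisensteinGenerator k p Φ x) {z w : L} (hz : IsIntegral A z) (hw : IsIntegral A w)
    {m : ℕ} (hzw : z ^ m = x * w) : ∃ w', IsIntegral A w' ∧ z = x * w' := by
  obtain ⟨f, rfl⟩ := h.exists_aeval_eq hz
  obtain ⟨e, rfl⟩ := h.exists_aeval_eq hw
  obtain ⟨c, hc⟩ := (h.aeval_eq_zero_iff (f ^ m - X * e)).1 (by simp [hzw])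
  have h0 := congrArg (coeff · 0) hc
  simp only [coeff_sub, mul_coeff_zero, coeff_X_zero, zero_mul, sub_zero, h.coeff_zero] at h0
  rw [coeff_zero_eq_eval_zero, eval_pow, ← coeff_zero_eq_eval_zero] at h0
  obtain ⟨b, hb⟩ := h.prime.dvd_of_dvd_pow ⟨_, h0⟩
  obtain ⟨v, hv, hpv⟩ := h.exists_algebraMap_prime_eq
  refine ⟨aeval x f.divX + v * algebraMap A L b,
    (h.isIntegral_aeval _).add (hv.mul isIntegral_algebraMap), ?_⟩
  conv_lhs => rw [← divX_mul_X_add f]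
  simp only [hb, map_add, map_mul, aeval_X, aeval_C, hpv]
  ring

/-- The conjugates of `x` are divisible by `x`, as their `n`-th powers are divisible by `p`. -/
theorem exists_galois_eq_mul [Algebra.IsSeparable k L] (h : IsEisensteinGenerator k p Φ x)
    (τ : L ≃ₐ[k] L) : ∃ w, IsIntegral A w ∧ τ x = x * w := by
  obtain ⟨e, he⟩ := h.exists_eq_X_pow_add
  obtain ⟨v, hv, hpv⟩ := h.exists_algebraMap_prime_eq
  let f : L →ₐ[A] L := (τ : L →ₐ[k] L).restrictScalars A
  have hx : IsIntegral A (τ x) := h.isIntegral.map f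
  have h0 : aeval (τ x) Φ = 0 := by
    change aeval (f x) Φ = 0
    rw [aeval_algHom_apply, h.aeval_eq_zero, map_zero]
  have he' : IsIntegral A (aeval (τ x) e) :=
    adjoin_le_integralClosure hx (aeval_mem_adjoin_singleton A _)
  refine h.exists_eq_gen_mul_of_pow_eq_mul hx (hv.mul he').neg (m := Φ.natDegree) ?_
  rw [he] at h0
  simp only [map_add, map_pow, map_mul, aeval_X, aeval_C, hpv] at h0
  linear_combination h0

/-- The conjugates of `x` are associated to `x`. -/
theorem isIntegralUnit_galois_div [Algebra.IsSeparable k L] (h : IsEisensteinGenerator k p Φ x)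
    (τ : L ≃ₐ[k] L) : IsIntegralUnit A (τ x / x) := by
  have hx := h.ne_zero
  have hτx : τ x ≠ 0 := (map_ne_zero τ).2 hx
  refine ⟨div_ne_zero hτx hx, ?_, ?_⟩
  · obtain ⟨w, hw, e⟩ := h.exists_galois_eq_mul τ
    rw [e, mul_div_cancel_left₀ _ hx]
    exact hw
  · obtain ⟨w, hw, e⟩ := h.exists_galois_eq_mul τ⁻¹
    have e' : x = τ x * τ w := by
      rw [← map_mul, ← e]
      exact (AlgEquiv.apply_symm_apply τ x).symm
    have hw' : x / τ x = τ w := by rw [div_eq_iff hτx, mul_comm, ← e']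
    rw [inv_div, hw']
    exact hw.map ((τ : L →ₐ[k] L).restrictScalars A)

/-- Total ramification: `x ^ n` and `p` are associated, `n` being the degree of `L` over `k`. -/
theorem isIntegralUnit_pow_div [IsGalois k L] (h : IsEisensteinGenerator k p Φ x) :
    IsIntegralUnit A (x ^ Φ.natDegree / algebraMap A L p) := by
  have hfin : FiniteDimensional k L := h.powerBasis.finite
  have hn := Algebra.norm_eq_prod_automorphisms k x
  have hu : IsIntegralUnit A (∏ τ : L ≃ₐ[k] L, τ x / x) :=
    .prod fun τ _ ↦ h.isIntegralUnit_galois_div τ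
  rw [Finset.prod_div_distrib, ← hn, Finset.prod_const, Finset.card_univ,
    ← Nat.card_eq_fintype_card, IsGalois.card_aut_eq_finrank, h.finrank_eq, h.norm_eq] at hu
  have hs : IsIntegralUnit A ((-1 : L) ^ Φ.natDegree) := IsIntegralUnit.one.neg.pow _
  have := (hu.mul hs).inv
  simp only [map_mul, map_pow, map_neg, map_one, ← IsScalarTower.algebraMap_apply] at this
  convert this using 1
  have h1 : ((-1 : L) ^ Φ.natDegree) * (-1) ^ Φ.natDegree = 1 := by
    rw [← mul_pow]; simp
  rw [div_mul_eq_mul_div, inv_div, mul_right_comm, h1, one_mul]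

end IsEisensteinGenerator

/-! ### Units of norm one -/

namespace IsEisensteinGenerator

variable {A k L : Type*} [CommRing A] [IsDomain A] [IsPrincipalIdealRing A] [Field k] [Field L]
  [Algebra A k] [IsFractionRing A k] [Algebra A L] [Algebra k L] [IsScalarTower A k L]
  {p : A} {Φ : A[X]} {x : L}

/-- An integral element whose `n`-th power is associated to an element of `A` is, up to a unit, the
product of an element of `A` and a power of `x`: a prime factor of `c` other than `p` can be split
off from `z`, and so can `x` if `p` divides `c`. -/
theorem exists_eq_mul_pow_mul [IsGalois k L] (h : IsEisensteinGenerator k p Φ x) (c : A) :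
    c ≠ 0 → ∀ z v : L, IsIntegral A z → IsIntegralUnit A v →
      z ^ Φ.natDegree = v * algebraMap A L c →
      ∃ (a : A) (j : ℕ) (u : L), a ≠ 0 ∧ IsIntegralUnit A u ∧
        z = algebraMap A L a * x ^ j * u := by
  have : FaithfulSMul A L := .trans A k L
  have hinj := FaithfulSMul.algebraMap_injective A L
  have hn : Φ.natDegree ≠ 0 := h.natDegree_pos.ne'
  induction c using (wellFounded_dvdNotUnit (α := A)).induction with
  | _ c ih =>
  intro hc z v hz hv hzv
  have hc' : algebraMap A L c ≠ 0 := (map_ne_zero_iff _ hinj).2 hc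
  by_cases hu : IsUnit c
  · refine ⟨1, 0, z, one_ne_zero, .of_pow hz hn ?_, by simp⟩
    rw [hzv]
    exact hv.mul (.of_isUnit hu)
  obtain ⟨r, hr, hrc⟩ := WfDvdMonoid.exists_irreducible_factor hu hc
  replace hr := hr.prime
  have hr0 : algebraMap A L r ≠ 0 := (map_ne_zero_iff _ hinj).2 hr.ne_zero
  by_cases hrp : r ∣ p
  · obtain ⟨d, rfl⟩ : p ∣ c := (hr.associated_of_dvd h.prime hrp).symm.dvd.trans hrc
    have hd := right_ne_zero_of_mul hc
    have hp' : algebraMap A L p ≠ 0 := (map_ne_zero_iff _ hinj).2 h.prime.ne_zero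
    obtain ⟨w, hw, hpw⟩ := h.exists_algebraMap_prime_eq
    obtain ⟨z', hz', rfl⟩ := h.exists_eq_gen_mul_of_pow_eq_mul (m := Φ.natDegree) hz
      ((hv.2.1.mul hw).mul (isIntegral_algebraMap (x := d)))
      (by rw [hzv, map_mul, hpw]; ring)
    obtain ⟨a, j, u, ha, hu, e⟩ := ih d ⟨hd, p, h.prime.not_isUnit, mul_comm _ _⟩ hd z' _ hz'
      (hv.div h.isIntegralUnit_pow_div) (by
        rw [mul_pow, map_mul] at hzv
        have := pow_ne_zero Φ.natDegree h.ne_zero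
        field_simp
        linear_combination hzv)
    exact ⟨a, j + 1, u, ha, hu, by rw [e]; ring⟩
  · obtain ⟨d, hd⟩ := hrc
    obtain ⟨z', hz', rfl⟩ := h.exists_eq_mul_of_pow_eq_mul (m := Φ.natDegree) hr hrp hz
      (hv.2.1.mul (isIntegral_algebraMap (x := d))) hn
      (by rw [hzv, hd, map_mul]; ring)
    have hr0' := pow_ne_zero Φ.natDegree hr0
    -- `r ^ n` divides `c` in `A`, since the quotient is integral over `A`.
    obtain ⟨b, hb⟩ : ∃ b, algebraMap A k b = algebraMap A k c / algebraMap A k r ^ Φ.natDegree := by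
      apply IsIntegrallyClosed.isIntegral_iff.1
      rw [← isIntegral_algebraMap_iff (algebraMap k L).injective]
      have : algebraMap k L (algebraMap A k c / algebraMap A k r ^ Φ.natDegree)
          = z' ^ Φ.natDegree * v⁻¹ := by
        rw [map_div₀, map_pow, ← IsScalarTower.algebraMap_apply, ← IsScalarTower.algebraMap_apply]
        have := hv.1
        rw [mul_pow] at hzv
        field_simp
        linear_combination -hzv
      rw [this]
      exact (hz'.pow _).mul hv.2.2
    have hbc : c = r ^ Φ.natDegree * b := by
      apply IsFractionRing.injective A k
      rw [map_mul, map_pow, hb, mul_div_cancel₀]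
      exact pow_ne_zero _ ((map_ne_zero_iff _ (IsFractionRing.injective A k)).2 hr.ne_zero)
    have hb0 : b ≠ 0 := by rintro rfl; exact hc (by rw [hbc, mul_zero])
    obtain ⟨a, j, u, ha, hu, e⟩ := ih b ⟨hb0, r ^ Φ.natDegree,
        fun hu ↦ hr.not_isUnit ((isUnit_pow_iff hn).1 hu), by rw [hbc, mul_comm]⟩ hb0 z' v hz'
      hv (by
      rw [hbc, mul_pow, map_mul, map_pow] at hzv
      apply mul_left_cancel₀ hr0'
      linear_combination hzv)
    exact ⟨r * a, j, u, mul_ne_zero hr.ne_zero ha, hu, by rw [e, map_mul]; ring⟩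

/-- An element whose ratios with its conjugates are units is, up to a unit, the product of an
element of `k` and one of the powers `1, x, …, x ^ (n - 1)`. -/
theorem exists_eq_algebraMap_mul_pow_mul [IsGalois k L] (h : IsEisensteinGenerator k p Φ x) {y : L}
    (hy : y ≠ 0) (hyτ : ∀ τ : L ≃ₐ[k] L, IsIntegralUnit A (τ y / y)) :
    ∃ (a : k) (l : ℕ) (u : L), l < Φ.natDegree ∧ IsIntegralUnit A u ∧
      y = algebraMap k L a * x ^ l * u := by
  have hfin : FiniteDimensional k L := h.powerBasis.finite
  have : FaithfulSMul A L := .trans A k L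
  have hinj := FaithfulSMul.algebraMap_injective A L
  have halg : Algebra.IsAlgebraic A k := IsLocalization.isAlgebraic k (nonZeroDivisors A)
  have halg : Algebra.IsAlgebraic A L := .trans A k L
  obtain ⟨b, hb, hz⟩ := (halg.isAlgebraic y).exists_integral_multiple
  have hb' : algebraMap A L b ≠ 0 := (map_ne_zero_iff _ hinj).2 hb
  set z := b • y with hzdef
  rw [Algebra.smul_def] at hzdef
  have hz0 : z ≠ 0 := by rw [hzdef]; exact mul_ne_zero hb' hy
  have hzτ (τ : L ≃ₐ[k] L) : τ z / z = τ y / y := by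
    rw [hzdef, map_mul, IsScalarTower.algebraMap_apply A k L, τ.commutes,
      ← IsScalarTower.algebraMap_apply, mul_div_mul_left _ _ hb']
  -- The norm of `z` lies in `A` and is associated to `z ^ n`.
  obtain ⟨c, hc⟩ := IsIntegrallyClosed.isIntegral_iff.1 (Algebra.isIntegral_norm k hz)
  have hn := Algebra.norm_eq_prod_automorphisms k z
  have hu : IsIntegralUnit A (∏ τ : L ≃ₐ[k] L, τ z / z) :=
    .prod fun τ _ ↦ by rw [hzτ]; exact hyτ τ
  rw [Finset.prod_div_distrib, ← hn, Finset.prod_const, Finset.card_univ,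
    ← Nat.card_eq_fintype_card, IsGalois.card_aut_eq_finrank, h.finrank_eq, ← hc,
    ← IsScalarTower.algebraMap_apply] at hu
  have hc0 : algebraMap A L c ≠ 0 := by
    intro h0
    exact hu.1 (by rw [h0, zero_div])
  obtain ⟨a, j, u, ha, hu', e⟩ := h.exists_eq_mul_pow_mul c (by rintro rfl; simp at hc0) z _ hz
    hu.inv (by field_simp)
  refine ⟨algebraMap A k a * algebraMap A k p ^ (j / Φ.natDegree) / algebraMap A k b,
    j % Φ.natDegree, (x ^ Φ.natDegree / algebraMap A L p) ^ (j / Φ.natDegree) * u,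
    Nat.mod_lt _ h.natDegree_pos, (h.isIntegralUnit_pow_div.pow _).mul hu', ?_⟩
  have hp' : algebraMap A L p ≠ 0 := (map_ne_zero_iff _ hinj).2 h.prime.ne_zero
  have hpow : x ^ j = (x ^ Φ.natDegree) ^ (j / Φ.natDegree) * x ^ (j % Φ.natDegree) := by
    rw [← pow_mul, ← pow_add, Nat.div_add_mod]
  simp only [map_div₀, map_mul, map_pow, ← IsScalarTower.algebraMap_apply]
  rw [hpow] at e
  rw [div_pow]
  field_simp
  rw [mul_comm y, ← hzdef, e]
  ring

/-- Every unit of norm one is of the form `(x / σ x) ^ l * (Q(x) / σ (Q(x)))`: by Hilbert's Theorem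
90 it is `y / σ y`, where `y` has the same divisor as its conjugates. -/
theorem exists_unit_representation [IsGalois k L] (h : IsEisensteinGenerator k p Φ x)
    {σ : L ≃ₐ[k] L} (hσ : ∀ τ : L ≃ₐ[k] L, τ ∈ Subgroup.zpowers σ) {ε : L}
    (hε : IsIntegralUnit A ε) (hnorm : Algebra.norm k ε = 1) :
    ∃ (l : ℕ) (Q : A[X]), l < Φ.natDegree ∧ Q.natDegree < Φ.natDegree ∧
      IsIntegralUnit A (aeval x Q) ∧ ε = (x / σ x) ^ l * (aeval x Q / σ (aeval x Q)) := by
  have hfin : FiniteDimensional k L := h.powerBasis.finite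
  obtain ⟨y, hy0, hy⟩ := exists_div_galois_eq_of_norm_eq_one hσ hnorm
  have hmul {τ ρ : L ≃ₐ[k] L} (hτ : IsIntegralUnit A (τ y / y)) (hρ : IsIntegralUnit A (ρ y / y)) :
      IsIntegralUnit A ((τ * ρ) y / y) := by
    let f : L →ₐ[A] L := (τ : L →ₐ[k] L).restrictScalars A
    have h1 := (hρ.map f).mul hτ
    have h2 : τ y ≠ 0 := (map_ne_zero τ).2 hy0
    have : f (ρ y / y) = (τ * ρ) y / τ y := map_div₀ τ _ _
    rwa [this, div_mul_div_cancel₀ h2] at h1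
  have hyσ : IsIntegralUnit A (σ y / y) := by
    rw [← inv_div, hy]
    exact hε.inv
  have hyτ (τ : L ≃ₐ[k] L) : IsIntegralUnit A (τ y / y) := by
    obtain ⟨m, rfl⟩ := (isOfFinOrder_of_finite σ).mem_powers_iff_mem_zpowers.2 (hσ τ)
    dsimp only
    induction m with
    | zero => simpa [hy0] using IsIntegralUnit.one
    | succ m ih => rw [pow_succ]; exact hmul ih hyσ
  obtain ⟨a, l, u, hl, hu, e⟩ := h.exists_eq_algebraMap_mul_pow_mul hy0 hyτ
  obtain ⟨f, hf⟩ := h.exists_aeval_eq hu.2.1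
  have hfQ : aeval x (f %ₘ Φ) = u := by
    rw [← hf]
    conv_rhs => rw [← modByMonic_add_div f Φ]
    simp [h.aeval_eq_zero]
  have hQ : (f %ₘ Φ).natDegree < Φ.natDegree :=
    natDegree_modByMonic_lt f h.monic fun h1 ↦ by simpa [h1] using h.natDegree_pos
  refine ⟨l, f %ₘ Φ, hl, hQ, by rwa [hfQ], ?_⟩
  rw [hfQ, ← hy, e]
  have ha : algebraMap k L a ≠ 0 := by
    intro h0
    exact hy0 (by rw [e, h0, zero_mul, zero_mul])
  rw [map_mul, map_mul, σ.commutes, map_pow, mul_assoc, mul_assoc, mul_div_mul_left _ _ ha,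
    mul_div_mul_comm, div_pow]

/-- If `x ^ l * u` and `x ^ m * w` differ by a factor in `k`, with units `u` and `w`, then
`m ≤ l`: otherwise the factor is divisible by `x`, hence by `p`, and `p ~ x ^ n` does not divide
`x ^ (m - l)`. -/
theorem le_of_pow_mul_eq [IsGalois k L] (h : IsEisensteinGenerator k p Φ x) {l m : ℕ}
    (hm : m < Φ.natDegree) {u w : L} (hu : IsIntegralUnit A u) (hw : IsIntegralUnit A w) {a : k}
    (e : algebraMap k L a * (x ^ l * u) = x ^ m * w) : m ≤ l := by
  have : FaithfulSMul A L := .trans A k L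
  have hinj := FaithfulSMul.algebraMap_injective A L
  have hp' : algebraMap A L p ≠ 0 := (map_ne_zero_iff _ hinj).2 h.prime.ne_zero
  have hx := h.ne_zero
  by_contra! hlm
  obtain ⟨j, rfl⟩ : ∃ j, m = l + (j + 1) := ⟨m - l - 1, by omega⟩
  have hu0 := hu.1
  have e' : algebraMap k L a = x ^ (j + 1) * (w / u) := by
    rw [mul_div_assoc', eq_div_iff hu0]
    apply mul_left_cancel₀ (pow_ne_zero l hx)
    rw [pow_add] at e
    linear_combination e
  obtain ⟨c, rfl⟩ := IsIntegrallyClosed.isIntegral_iff.1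
    ((isIntegral_algebraMap_iff (algebraMap k L).injective).1
      (e' ▸ (h.isIntegral.pow (j + 1)).mul (hw.div hu).2.1))
  rw [← IsScalarTower.algebraMap_apply] at e'
  -- `c ^ n` is associated to `p ^ (j + 1)`.
  have key : algebraMap A L c ^ Φ.natDegree = algebraMap A L p ^ (j + 1) *
      ((x ^ Φ.natDegree / algebraMap A L p) ^ (j + 1) * (w / u) ^ Φ.natDegree) := by
    rw [e', mul_pow, ← pow_mul, mul_comm (j + 1), pow_mul, div_pow (x ^ _)]
    field_simp
  have hv := (h.isIntegralUnit_pow_div.pow (j + 1)).mul ((hw.div hu).pow Φ.natDegree)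
  set v := (x ^ Φ.natDegree / algebraMap A L p) ^ (j + 1) * (w / u) ^ Φ.natDegree
  -- Integral quotients of elements of `A` lie in `A`.
  have hdvd {s t : A} {z : L} (hz : IsIntegral A z) (hs : s ≠ 0)
      (hst : algebraMap A L t = algebraMap A L s * z) : s ∣ t := by
    have hs' : algebraMap A k s ≠ 0 := (map_ne_zero_iff _ (IsFractionRing.injective A k)).2 hs
    have hs'' : algebraMap A L s ≠ 0 := (map_ne_zero_iff _ hinj).2 hs
    have hq : algebraMap k L (algebraMap A k t / algebraMap A k s) = z := by
      rw [map_div₀, ← IsScalarTower.algebraMap_apply, ← IsScalarTower.algebraMap_apply, hst,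
        mul_div_cancel_left₀ _ hs'']
    obtain ⟨b, hb⟩ := IsIntegrallyClosed.isIntegral_iff.1
      ((isIntegral_algebraMap_iff (algebraMap k L).injective).1 (hq ▸ hz))
    refine ⟨b, IsFractionRing.injective A k ?_⟩
    rw [map_mul, hb, mul_div_cancel₀ _ hs']
  have h1 : p ^ (j + 1) ∣ c ^ Φ.natDegree :=
    hdvd hv.2.1 (pow_ne_zero _ h.prime.ne_zero) (by rw [map_pow, map_pow, key])
  obtain ⟨d, rfl⟩ := h.prime.dvd_of_dvd_pow ((dvd_pow_self p j.succ_ne_zero).trans h1)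
  have h2 : p ^ Φ.natDegree ∣ p ^ (j + 1) := by
    refine hdvd (z := algebraMap A L d ^ Φ.natDegree * v⁻¹)
      ((isIntegral_algebraMap.pow _).mul hv.2.2) (pow_ne_zero _ h.prime.ne_zero) ?_
    have := hv.1
    rw [map_mul, mul_pow] at key
    rw [map_pow, map_pow]
    field_simp
    linear_combination -key
  have := (pow_dvd_pow_iff h.prime.ne_zero h.prime.not_isUnit).1 h2
  omega

/-- The exponent `l` and the unit `Q(x)`, up to a unit of `A`, are determined by
`(x / σ x) ^ l * (Q(x) / σ (Q(x)))`. -/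
theorem unit_representation_unique [IsGalois k L] (h : IsEisensteinGenerator k p Φ x)
    {σ : L ≃ₐ[k] L} (hσ : ∀ τ : L ≃ₐ[k] L, τ ∈ Subgroup.zpowers σ) {l m : ℕ} {Q R : A[X]}
    (hl : l < Φ.natDegree) (hm : m < Φ.natDegree) (hQ : Q.natDegree < Φ.natDegree)
    (hR : R.natDegree < Φ.natDegree) (hQu : IsIntegralUnit A (aeval x Q))
    (hRu : IsIntegralUnit A (aeval x R))
    (e : (x / σ x) ^ l * (aeval x Q / σ (aeval x Q)) =
      (x / σ x) ^ m * (aeval x R / σ (aeval x R))) :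
    m = l ∧ ∃ v : Aˣ, R = C (v : A) * Q := by
  have hfin : FiniteDimensional k L := h.powerBasis.finite
  have : FaithfulSMul A L := .trans A k L
  have hx := h.ne_zero
  have hσx : σ x ≠ 0 := (map_ne_zero σ).2 hx
  have hQ0 := hQu.1
  have hR0 := hRu.1
  have hσQ : σ (aeval x Q) ≠ 0 := (map_ne_zero σ).2 hQ0
  have hσR : σ (aeval x R) ≠ 0 := (map_ne_zero σ).2 hR0
  set y := x ^ m * aeval x R / (x ^ l * aeval x Q) with hy
  have hyσ : σ y = y := by
    rw [hy]
    simp only [map_div₀, map_mul, map_pow]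
    rw [div_pow, div_pow] at e
    field_simp at e ⊢
    linear_combination e
  obtain ⟨a, ha⟩ : ∃ a : k, algebraMap k L a = y := by
    refine IntermediateField.mem_bot.1 ((IsGalois.mem_bot_iff_fixed y).2 fun τ ↦ ?_)
    have : σ ∈ MulAction.stabilizer (L ≃ₐ[k] L) y := hyσ
    exact (Subgroup.zpowers_le.2 this) (hσ τ)
  have e1 : algebraMap k L a * (x ^ l * aeval x Q) = x ^ m * aeval x R := by
    rw [ha, hy]; field_simp
  have ha0 : algebraMap k L a ≠ 0 := by
    rw [ha, hy]
    positivity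
  have hml : m = l := by
    refine le_antisymm (h.le_of_pow_mul_eq hm hQu hRu e1)
      (h.le_of_pow_mul_eq hl hRu hQu (a := a⁻¹) ?_)
    rw [← e1, map_inv₀, inv_mul_cancel_left₀ ha0]
  subst hml
  have e2 : algebraMap k L a * aeval x Q = aeval x R := by
    apply mul_left_cancel₀ (pow_ne_zero m hx)
    linear_combination e1
  have hau : IsIntegralUnit A (algebraMap k L a) := by
    rw [eq_div_of_mul_eq hQ0 e2]
    exact hRu.div hQu
  obtain ⟨c, rfl⟩ := IsIntegrallyClosed.isIntegral_iff.1
    ((isIntegral_algebraMap_iff (algebraMap k L).injective).1 hau.2.1)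
  obtain ⟨d, hd⟩ := IsIntegrallyClosed.isIntegral_iff.1
    ((isIntegral_algebraMap_iff (algebraMap k L).injective).1
      (by rw [map_inv₀]; exact hau.2.2 :
        IsIntegral A (algebraMap k L (algebraMap A k c)⁻¹)))
  have hcd : c * d = 1 := by
    apply IsFractionRing.injective A k
    rw [map_mul, hd, map_one, mul_inv_cancel₀]
    exact fun h0 ↦ ha0 (by rw [h0, map_zero])
  refine ⟨rfl, .mkOfMulEqOne c d hcd, ?_⟩
  have h0 : Φ ∣ R - C c * Q := by
    rw [← h.aeval_eq_zero_iff, map_sub, map_mul, aeval_C, ← e2,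
      IsScalarTower.algebraMap_apply A k L, sub_self]
  refine sub_eq_zero.1 (eq_zero_of_dvd_of_natDegree_lt h0 ?_)
  refine (natDegree_sub_le _ _).trans_lt (max_lt hR ?_)
  exact (natDegree_C_mul_le c Q).trans_lt hQ

end IsEisensteinGenerator

/-! ### The polynomials of the Carlitz module -/

/-- An induction principle for `𝔽_q[T]` following the structure `C_{Ta} = T C_a + C_a ^ q` of the
Carlitz module. -/
theorem Polynomial.induction_X_mul {F : Type*} [Field F] {motive : F[X] → Prop}
    (a : F[X]) (const : ∀ c, motive (C c))
    (add : ∀ a b, motive a → motive b → motive (a + b)) (X_mul : ∀ a, motive a → motive (X * a)) :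
    motive a := by
  induction a using Polynomial.induction_on with
  | C c => exact const c
  | add a b ha hb => exact add a b ha hb
  | monomial n c ih =>
    rw [pow_succ, ← mul_assoc, mul_comm]
    exact X_mul _ ih

section carlitz

variable {F : Type*} [Field F] [Fintype F]

theorem carlitzPoly_X_mul (a : F[X]) :
    carlitzPoly (X * a) = C X * carlitzPoly a + carlitzPoly a ^ Fintype.card F := by
  rw [carlitzPoly_mul, carlitzPoly_T]
  simp

theorem carlitzPoly_zero : carlitzPoly (0 : F[X]) = 0 := by simp [carlitzPoly]

theorem carlitzPoly_one : carlitzPoly (1 : F[X]) = X := by simp [carlitzPoly]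

theorem derivative_carlitzPoly (a : F[X]) : derivative (carlitzPoly a) = C a := by
  induction a using Polynomial.induction_X_mul with
  | const c => simp [carlitzPoly_const]
  | add a b ha hb => simp [carlitzPoly_add, ha, hb]
  | X_mul a ha =>
    have hq : (Fintype.card F : F[X]) = 0 := by
      rw [← map_natCast (C : F →+* F[X]), FiniteField.cast_card_eq_zero, C_0]
    rw [carlitzPoly_X_mul, derivative_add, derivative_pow, hq, derivative_C_mul, ha]
    simp

theorem carlitzPoly_coeff_zero (a : F[X]) : (carlitzPoly a).coeff 0 = 0 := by
  induction a using Polynomial.induction_X_mul with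
  | const c => simp [carlitzPoly_const]
  | add a b ha hb => simp [carlitzPoly_add, ha, hb]
  | X_mul a ha =>
    rw [coeff_zero_eq_eval_zero] at ha ⊢
    simp [carlitzPoly_X_mul, ha]

theorem carlitzPoly_coeff_one (a : F[X]) : (carlitzPoly a).coeff 1 = a := by
  have := congrArg (coeff · 0) (derivative_carlitzPoly a)
  simpa [coeff_derivative] using this

/-- The polynomial `C_a(x)` has degree at most `q ^ n` for `a` of degree at most `n`, and the
coefficient of `x ^ (q ^ n)` in `C_a(x)` is that of `T ^ n` in `a`. -/
theorem natDegree_carlitzPoly_le_and_coeff (n : ℕ) : ∀ a : F[X], a.natDegree ≤ n →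
    (carlitzPoly a).natDegree ≤ Fintype.card F ^ n ∧
      (carlitzPoly a).coeff (Fintype.card F ^ n) = C (a.coeff n) := by
  have hq : 1 < Fintype.card F := Fintype.one_lt_card
  induction n with
  | zero =>
    intro a ha
    rw [eq_C_of_natDegree_le_zero ha, carlitzPoly_const]
    exact ⟨(natDegree_C_mul_le _ _).trans (by simp), by simp⟩
  | succ n ih =>
    intro a ha
    obtain ⟨h1, h2⟩ := ih a.divX (by rw [natDegree_divX_eq_natDegree_tsub_one]; omega)
    have hlt : Fintype.card F ^ n < Fintype.card F ^ (n + 1) :=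
      Nat.pow_lt_pow_right hq n.lt_succ_self
    have h1lt : 1 < Fintype.card F ^ (n + 1) := Nat.one_lt_pow n.succ_ne_zero hq
    have ha' : carlitzPoly a = C X * carlitzPoly a.divX + carlitzPoly a.divX ^ Fintype.card F +
        C (C (a.coeff 0)) * X := by
      conv_lhs => rw [← X_mul_divX_add a]
      rw [carlitzPoly_add, carlitzPoly_X_mul, carlitzPoly_const]
    constructor
    · rw [ha']
      refine natDegree_add_le_of_degree_le (natDegree_add_le_of_degree_le
        ((natDegree_C_mul_le _ _).trans (h1.trans hlt.le)) ?_) ?_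
      · exact (natDegree_pow_le_of_le _ h1).trans (by rw [pow_succ, mul_comm])
      · exact (natDegree_C_mul_le _ _).trans (by simpa using h1lt.le)
    · rw [ha', coeff_add, coeff_add, coeff_C_mul, coeff_C_mul, coeff_X_of_ne_one h1lt.ne',
        coeff_eq_zero_of_natDegree_lt (h1.trans_lt hlt), pow_succ, mul_comm (_ ^ n),
        coeff_pow_of_natDegree_le h1, h2, ← C_pow, FiniteField.pow_card, coeff_divX]
      simp

/-- The coefficients of `f ^ q`: since `f ↦ f ^ q` is additive, they are the `q`-th powers of the
coefficients of `f`, at the multiples of `q`. -/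
theorem coeff_pow_card (f : F[X][X]) (m : ℕ) : (f ^ Fintype.card F).coeff m =
    if Fintype.card F ∣ m then f.coeff (m / Fintype.card F) ^ Fintype.card F else 0 := by
  obtain ⟨p, hp⟩ := CharP.exists F
  obtain ⟨n, hpp, hn⟩ := FiniteField.card F p
  have : Fact p.Prime := ⟨hpp⟩
  rw [hn, ← map_iterateFrobenius_expand, coeff_map, coeff_expand (pow_pos hpp.pos _)]
  split_ifs <;> simp [iterateFrobenius_def, hpp.ne_zero]

/-- Only powers `x ^ (q ^ i)` occur in `C_a(x)`. -/
theorem carlitzPoly_coeff_eq_zero (a : F[X]) {m : ℕ} (hm : ∀ i, m ≠ Fintype.card F ^ i) :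
    (carlitzPoly a).coeff m = 0 := by
  induction a using Polynomial.induction_X_mul generalizing m with
  | const c =>
    rw [carlitzPoly_const, coeff_C_mul, coeff_X_of_ne_one (by simpa using hm 0), mul_zero]
  | add a b ha hb => rw [carlitzPoly_add, coeff_add, ha hm, hb hm, add_zero]
  | X_mul a ha =>
    rw [carlitzPoly_X_mul, coeff_add, coeff_C_mul, ha hm, coeff_pow_card, mul_zero, zero_add]
    split_ifs with h
    · obtain ⟨m, rfl⟩ := h
      rw [Nat.mul_div_cancel_left _ Fintype.card_pos, ha, zero_pow Fintype.card_ne_zero]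
      rintro i rfl
      exact hm (i + 1) (pow_succ' _ _).symm
    · rfl

/-- The coefficients of `C_{Ta} = C_T ∘ C_a`. -/
theorem carlitzPoly_X_mul_coeff (a : F[X]) (i : ℕ) :
    (carlitzPoly (X * a)).coeff (Fintype.card F ^ (i + 1)) =
      X * (carlitzPoly a).coeff (Fintype.card F ^ (i + 1)) +
        (carlitzPoly a).coeff (Fintype.card F ^ i) ^ Fintype.card F := by
  rw [carlitzPoly_X_mul, coeff_add, coeff_C_mul, coeff_pow_card,
    if_pos (dvd_pow_self _ i.succ_ne_zero), pow_succ, Nat.mul_div_cancel _ Fintype.card_pos]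

/-- The coefficients of `C_{aT} = C_a ∘ C_T`. -/
theorem carlitzPoly_X_mul_coeff' (a : F[X]) (i : ℕ) :
    (carlitzPoly (X * a)).coeff (Fintype.card F ^ (i + 1)) =
      X ^ Fintype.card F ^ (i + 1) * (carlitzPoly a).coeff (Fintype.card F ^ (i + 1)) +
        (carlitzPoly a).coeff (Fintype.card F ^ i) := by
  have hq : 1 < Fintype.card F := Fintype.one_lt_card
  induction a using Polynomial.induction_X_mul generalizing i with
  | const c =>
    have h (j : ℕ) : (X : F[X][X]).coeff (Fintype.card F ^ (j + 1)) = 0 :=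
      coeff_X_of_ne_one (Nat.one_lt_pow j.succ_ne_zero hq).ne'
    rw [carlitzPoly_X_mul_coeff, carlitzPoly_const]
    simp only [coeff_C_mul, h]
    cases i with
    | zero => simp [← C_pow, FiniteField.pow_card]
    | succ i => simp [h, Fintype.card_ne_zero]
  | add a b ha hb =>
    rw [mul_add, carlitzPoly_add, carlitzPoly_add, coeff_add, ha, hb, coeff_add, coeff_add]
    ring
  | X_mul a ha =>
    have h1 := carlitzPoly_X_mul_coeff a
    rw [carlitzPoly_X_mul_coeff]
    cases i with
    | zero =>
      have h2 := ha 0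
      have h3 := h1 0
      simp only [pow_zero, carlitzPoly_coeff_one] at h2 h3 ⊢
      linear_combination X * h2 - X ^ Fintype.card F ^ (0 + 1) * h3
    | succ i =>
      have hadd (b c : F[X]) : (b + c) ^ Fintype.card F = b ^ Fintype.card F + c ^ Fintype.card F :=
        map_add (FiniteField.frobeniusAlgHom F F[X]) b c
      have h2 := congrArg (· ^ Fintype.card F) (ha i)
      simp only [hadd, mul_pow, ← pow_mul, ← pow_succ] at h2
      linear_combination X * ha (i + 1) - X ^ Fintype.card F ^ (i + 1 + 1) * h1 (i + 1) + h2 - h1 i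

/-- The coefficients of `C_P(x)` other than the leading one are divisible by the prime `P`. The
coefficients `c_i` at `x ^ (q ^ i)` satisfy `(T ^ (q ^ (i + 1)) - T) c_{i+1} = c_i ^ q - c_i`, by
`C_P C_T = C_T C_P`, and `P` does not divide `T ^ (q ^ i) - T` for `0 < i < deg P`. -/
theorem dvd_carlitzPoly_coeff {P : F[X]} (hP : Prime P) {i : ℕ} (hi : i < P.natDegree) :
    P ∣ (carlitzPoly P).coeff (Fintype.card F ^ i) := by
  induction i with
  | zero => rw [pow_zero, carlitzPoly_coeff_one]
  | succ i ih =>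
    have h1 := ih (by omega)
    have h2 : (X ^ Fintype.card F ^ (i + 1) - X) *
        (carlitzPoly P).coeff (Fintype.card F ^ (i + 1)) =
        (carlitzPoly P).coeff (Fintype.card F ^ i) ^ Fintype.card F -
          (carlitzPoly P).coeff (Fintype.card F ^ i) := by
      linear_combination carlitzPoly_X_mul_coeff P i - carlitzPoly_X_mul_coeff' P i
    have h3 : P ∣ (X ^ Fintype.card F ^ (i + 1) - X) *
        (carlitzPoly P).coeff (Fintype.card F ^ (i + 1)) := by
      rw [h2]
      exact dvd_sub (h1.trans (dvd_pow_self _ Fintype.card_ne_zero)) h1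
    refine (hP.dvd_or_dvd h3).resolve_left fun h4 ↦ ?_
    rw [← Nat.card_eq_fintype_card] at h4
    have := hP.irreducible.natDegree_dvd_of_dvd_X_pow_card_pow_sub_X h4
    exact absurd (Nat.le_of_dvd i.succ_pos this) (by omega)

/-- The polynomial `C_P(x) / x`, which is Eisenstein at `P` when `P` is a monic prime. -/
noncomputable def carlitzEisenstein (P : F[X]) : F[X][X] := (carlitzPoly P).divX

theorem X_mul_carlitzEisenstein (P : F[X]) : X * carlitzEisenstein P = carlitzPoly P := by
  conv_rhs => rw [← X_mul_divX_add (carlitzPoly P), carlitzPoly_coeff_zero, C_0, add_zero]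
  rfl

theorem natDegree_carlitzPoly {P : F[X]} (hP : P.Monic) :
    (carlitzPoly P).natDegree = Fintype.card F ^ P.natDegree := by
  obtain ⟨h1, h2⟩ := natDegree_carlitzPoly_le_and_coeff P.natDegree P le_rfl
  rw [hP.coeff_natDegree, C_1] at h2
  exact le_antisymm h1 (le_natDegree_of_ne_zero (by rw [h2]; exact one_ne_zero))

theorem monic_carlitzPoly {P : F[X]} (hP : P.Monic) : (carlitzPoly P).Monic := by
  rw [Monic, leadingCoeff, natDegree_carlitzPoly hP,
    (natDegree_carlitzPoly_le_and_coeff P.natDegree P le_rfl).2, hP.coeff_natDegree, C_1]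

theorem natDegree_carlitzEisenstein {P : F[X]} (hP : P.Monic) :
    (carlitzEisenstein P).natDegree = Fintype.card F ^ P.natDegree - 1 := by
  rw [carlitzEisenstein, natDegree_divX_eq_natDegree_tsub_one, natDegree_carlitzPoly hP]

theorem monic_carlitzEisenstein {P : F[X]} (hP : P.Monic) : (carlitzEisenstein P).Monic := by
  have := monic_carlitzPoly hP
  rw [← X_mul_carlitzEisenstein] at this
  exact monic_X.of_mul_monic_left this

theorem coeff_zero_carlitzEisenstein (P : F[X]) : (carlitzEisenstein P).coeff 0 = P := by
  rw [carlitzEisenstein, coeff_divX, carlitzPoly_coeff_one]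

theorem isEisensteinAt_carlitzEisenstein {P : F[X]} (hP : Prime P) (hm : P.Monic) :
    (carlitzEisenstein P).IsEisensteinAt (Ideal.span {P}) where
  leading := by
    rw [(monic_carlitzEisenstein hm).leadingCoeff, Ideal.mem_span_singleton]
    exact fun h ↦ hP.not_isUnit (isUnit_of_dvd_one h)
  mem := by
    intro j hj
    rw [natDegree_carlitzEisenstein hm] at hj
    rw [Ideal.mem_span_singleton, carlitzEisenstein, coeff_divX]
    by_cases h : ∃ i, j + 1 = Fintype.card F ^ i
    · obtain ⟨i, hi⟩ := h
      rw [hi]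
      refine dvd_carlitzPoly_coeff hP ?_
      rw [← Nat.pow_lt_pow_iff_right (Fintype.one_lt_card (α := F))]
      omega
    · push Not at h
      rw [carlitzPoly_coeff_eq_zero P h]
      exact dvd_zero P
  notMem := by
    rw [coeff_zero_carlitzEisenstein, Ideal.span_singleton_pow, Ideal.mem_span_singleton]
    intro h
    have := (pow_dvd_pow_iff (n := 2) (m := 1) hP.ne_zero hP.not_isUnit).1 (by simpa using h)
    omega

end carlitz

/-! ### Cyclotomic function fields -/

section cyclotomic

theorem coe_aeval_intermediateField {F : Type*} [Field F] {Ω : Type*} [Field Ω] [Algebra F[X] Ω]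
    [Algebra (RatFunc F) Ω] [IsScalarTower F[X] (RatFunc F) Ω]
    (K : IntermediateField (RatFunc F) Ω) (y : K) (f : F[X][X]) :
    ((aeval y f : K) : Ω) = aeval (y : Ω) f :=
  (aeval_algHom_apply (K.val.restrictScalars F[X]) y f).symm

variable {F : Type*} [Field F] [Fintype F]

theorem aeval_carlitzPoly_mul {S : Type*} [CommRing S] [Algebra F[X] S] (a b : F[X]) (y : S) :
    aeval y (carlitzPoly (a * b)) = aeval (aeval y (carlitzPoly b)) (carlitzPoly a) := by
  rw [carlitzPoly_mul, aeval_comp]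

/-- On a `P`-torsion element, the action of `A` factors through `A / P`. -/
theorem aeval_carlitzPoly_eq_of_dvd_sub {S : Type*} [CommRing S] [Algebra F[X] S] {P a b : F[X]}
    {y : S} (hy : aeval y (carlitzPoly P) = 0) (hab : P ∣ a - b) :
    aeval y (carlitzPoly a) = aeval y (carlitzPoly b) := by
  obtain ⟨c, hc⟩ := hab
  have h0 : aeval (0 : S) (carlitzPoly c) = 0 := by
    rw [aeval_def, eval₂_at_zero, carlitzPoly_coeff_zero, map_zero]
  rw [eq_add_of_sub_eq hc, carlitzPoly_add, map_add, mul_comm, aeval_carlitzPoly_mul, hy, h0,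
    zero_add]

variable {Ω : Type*} [Field Ω] [Algebra F[X] Ω] [Algebra (RatFunc F) Ω]
    [IsScalarTower F[X] (RatFunc F) Ω] {P : F[X]}

theorem exists_ne_zero_mem_carlitzTorsion [IsAlgClosed Ω] (hP : Prime P) (hm : P.Monic) :
    ∃ y ∈ carlitzTorsion P Ω, y ≠ 0 := by
  have hinj : Function.Injective (algebraMap F[X] Ω) := by
    rw [IsScalarTower.algebraMap_eq F[X] (RatFunc F) Ω]
    exact (algebraMap (RatFunc F) Ω).injective.comp (IsFractionRing.injective F[X] (RatFunc F))
  have hdeg : 0 < (carlitzEisenstein P).natDegree := by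
    rw [natDegree_carlitzEisenstein hm]
    have : 1 < Fintype.card F ^ P.natDegree :=
      Nat.one_lt_pow hP.irreducible.natDegree_pos.ne' Fintype.one_lt_card
    omega
  obtain ⟨y, hy⟩ := IsAlgClosed.exists_aeval_eq_zero_of_injective Ω hinj (carlitzEisenstein P)
    (natDegree_pos_iff_degree_pos.1 hdeg).ne'
  refine ⟨y, ?_, ?_⟩
  · change aeval y (carlitzPoly P) = 0
    rw [← X_mul_carlitzEisenstein P, map_mul, hy, mul_zero]
  · rintro rfl
    rw [aeval_def, eval₂_at_zero, coeff_zero_carlitzEisenstein, map_eq_zero_iff _ hinj] at hy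
    exact hP.ne_zero hy

theorem IsPrimitiveCarlitzRoot.ne_zero [IsAlgClosed Ω] (hP : Prime P) (hm : P.Monic) {lam : Ω}
    (hlam : IsPrimitiveCarlitzRoot P lam) : lam ≠ 0 := by
  rintro rfl
  obtain ⟨y, hy, hy0⟩ := exists_ne_zero_mem_carlitzTorsion (Ω := Ω) hP hm
  obtain ⟨a, rfl⟩ := hlam.2 y hy
  rw [aeval_def, eval₂_at_zero, carlitzPoly_coeff_zero, map_zero] at hy0
  exact hy0 rfl

/-- The primitive root `lam` as an element of the cyclotomic function field. -/
def IsPrimitiveCarlitzRoot.gen {lam : Ω} (hlam : IsPrimitiveCarlitzRoot P lam) :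
    CyclotomicFunctionField P Ω :=
  ⟨lam, IntermediateField.subset_adjoin _ _ hlam.1⟩

theorem IsPrimitiveCarlitzRoot.aeval_gen {lam : Ω} (hlam : IsPrimitiveCarlitzRoot P lam) :
    aeval hlam.gen (carlitzPoly P) = 0 := by
  apply Subtype.ext
  rw [coe_aeval_intermediateField]
  exact hlam.1

theorem IsPrimitiveCarlitzRoot.exists_eq_aeval_gen {lam : Ω} (hlam : IsPrimitiveCarlitzRoot P lam)
    {y : CyclotomicFunctionField P Ω} (hy : aeval y (carlitzPoly P) = 0) :
    ∃ a : F[X], y = aeval hlam.gen (carlitzPoly a) := by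
  obtain ⟨a, ha⟩ := hlam.2 y (by
    change aeval (y : Ω) (carlitzPoly P) = 0
    rw [← coe_aeval_intermediateField, hy]
    rfl)
  exact ⟨a, Subtype.ext (by rw [coe_aeval_intermediateField]; exact ha)⟩

theorem mem_rootSet_carlitzPoly (hm : P.Monic) (y : Ω) :
    y ∈ ((carlitzPoly P).map (algebraMap F[X] (RatFunc F))).rootSet Ω ↔
      y ∈ carlitzTorsion P Ω := by
  rw [mem_rootSet, aeval_map_algebraMap]
  exact and_iff_right ((monic_carlitzPoly hm).map _).ne_zero

theorem CyclotomicFunctionField.isGalois [IsAlgClosed Ω] (hP : Prime P) (hm : P.Monic) :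
    IsGalois (RatFunc F) (CyclotomicFunctionField P Ω) := by
  set f := (carlitzPoly P).map (algebraMap F[X] (RatFunc F)) with hf
  have hroot : f.rootSet Ω = carlitzTorsion P Ω := Set.ext (mem_rootSet_carlitzPoly hm)
  have hsplit : f.IsSplittingField (RatFunc F) (CyclotomicFunctionField P Ω) := by
    have := IntermediateField.adjoin_rootSet_isSplittingField (p := f) (L := Ω)
      (IsAlgClosed.splits _)
    rwa [hroot] at this
  refine IsGalois.of_separable_splitting_field (p := f) ?_
  have hP' : algebraMap F[X] (RatFunc F) P ≠ 0 :=
    (map_ne_zero_iff _ (IsFractionRing.injective F[X] (RatFunc F))).2 hP.ne_zero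
  rw [Polynomial.separable_def, hf, derivative_map, derivative_carlitzPoly, map_C]
  exact ⟨0, C (algebraMap F[X] (RatFunc F) P)⁻¹, by
    rw [zero_mul, zero_add, ← C_mul, inv_mul_cancel₀ hP', C_1]⟩

/-- The `P`-torsion of the Carlitz module makes the cyclotomic function field a totally ramified
extension at `P`, generated by any primitive root. -/
theorem IsPrimitiveCarlitzRoot.isEisensteinGenerator [IsAlgClosed Ω] (hP : Prime P) (hm : P.Monic)
    {lam : Ω} (hlam : IsPrimitiveCarlitzRoot P lam) :
    IsEisensteinGenerator (RatFunc F) P (carlitzEisenstein P) hlam.gen where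
  prime := hP
  monic := monic_carlitzEisenstein hm
  eisenstein := isEisensteinAt_carlitzEisenstein hP hm
  coeff_zero := coeff_zero_carlitzEisenstein P
  derivative_X_mul := by rw [X_mul_carlitzEisenstein, derivative_carlitzPoly]
  aeval_eq_zero := by
    have h1 := hlam.aeval_gen
    rw [← X_mul_carlitzEisenstein P, map_mul, aeval_X] at h1
    refine (mul_eq_zero.1 h1).resolve_left fun h0 ↦ hlam.ne_zero hP hm ?_
    exact congrArg Subtype.val h0
  adjoin_eq_top := by
    have halg : IsAlgebraic (RatFunc F) hlam.gen := by
      refine ⟨(carlitzPoly P).map (algebraMap F[X] (RatFunc F)),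
        ((monic_carlitzPoly hm).map _).ne_zero, ?_⟩
      rw [aeval_map_algebraMap, hlam.aeval_gen]
    have htop : IntermediateField.adjoin (RatFunc F) {hlam.gen} = ⊤ := by
      apply IntermediateField.map_injective (CyclotomicFunctionField P Ω).val
      rw [IntermediateField.adjoin_map, ← AlgHom.fieldRange_eq_map,
        IntermediateField.fieldRange_val, Set.image_singleton]
      refine le_antisymm (IntermediateField.adjoin_le_iff.2 ?_)
        (IntermediateField.adjoin_le_iff.2 fun y hy ↦ ?_)
      · rw [Set.singleton_subset_iff]
        exact hlam.gen.2
      · obtain ⟨a, rfl⟩ := hlam.2 y hy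
        have h := IntermediateField.mem_adjoin_simple_self (RatFunc F) lam
        have h2 := coe_aeval_intermediateField (IntermediateField.adjoin (RatFunc F) {lam})
          ⟨lam, h⟩ (carlitzPoly a)
        change _ = aeval lam _ at h2
        rw [← h2]
        exact Subtype.property _
    rw [← IntermediateField.adjoin_simple_toSubalgebra_of_isAlgebraic halg, htop]
    rfl

/-- The automorphism `σ : λ ↦ C_g(λ)` generates the Galois group. -/
theorem IsPrimitiveCarlitzRoot.exists_galois_generator [IsAlgClosed Ω] (hP : Prime P)
    (hm : P.Monic) {lam : Ω} (hlam : IsPrimitiveCarlitzRoot P lam) {g : F[X]}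
    (hg : IsPrimitiveRootModulo P g) :
    ∃ σ : CyclotomicFunctionField P Ω ≃ₐ[RatFunc F] CyclotomicFunctionField P Ω,
      σ hlam.gen = aeval hlam.gen (carlitzPoly g) ∧ ∀ τ, τ ∈ Subgroup.zpowers σ := by
  have h := hlam.isEisensteinGenerator hP hm
  have hfin : FiniteDimensional (RatFunc F) (CyclotomicFunctionField P Ω) := h.powerBasis.finite
  obtain ⟨u, hu, hgen⟩ := hg
  have hfinite : Finite (F[X] ⧸ Ideal.span {P}) := by
    have := hm.finite_quotient
    exact Module.finite_of_finite F
  -- `C_g(λ)` is a root of `C_P(x) / x`; it is nonzero because `g` is invertible modulo `P`.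
  have hroot : aeval (aeval hlam.gen (carlitzPoly g)) (carlitzEisenstein P) = 0 := by
    have h1 : aeval (aeval hlam.gen (carlitzPoly g)) (carlitzPoly P) = 0 := by
      rw [← aeval_carlitzPoly_mul, mul_comm, aeval_carlitzPoly_mul, hlam.aeval_gen, aeval_def,
        eval₂_at_zero, carlitzPoly_coeff_zero, map_zero]
    rw [← X_mul_carlitzEisenstein P, map_mul, aeval_X] at h1
    refine (mul_eq_zero.1 h1).resolve_left fun h0 ↦ h.ne_zero ?_
    obtain ⟨b, hb⟩ := Ideal.Quotient.mk_surjective (↑u⁻¹ : F[X] ⧸ Ideal.span {P})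
    have hdvd : P ∣ b * g - 1 := by
      rw [← Ideal.mem_span_singleton, ← Ideal.Quotient.eq, map_mul, hb, ← hu, map_one,
        Units.inv_mul]
    have h2 := aeval_carlitzPoly_eq_of_dvd_sub hlam.aeval_gen hdvd
    rw [aeval_carlitzPoly_mul, h0, carlitzPoly_one, aeval_X, aeval_def, eval₂_at_zero,
      carlitzPoly_coeff_zero, map_zero] at h2
    exact h2.symm
  have hmin : aeval (aeval hlam.gen (carlitzPoly g))
      (minpoly (RatFunc F) h.powerBasis.gen) = 0 := by
    rw [h.powerBasis_gen, h.minpoly_fractionRing, aeval_map_algebraMap, hroot]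
  let f := h.powerBasis.lift (aeval hlam.gen (carlitzPoly g)) hmin
  let σ : CyclotomicFunctionField P Ω ≃ₐ[RatFunc F] CyclotomicFunctionField P Ω :=
    AlgEquiv.ofBijective f f.bijective
  have hσ : σ hlam.gen = aeval hlam.gen (carlitzPoly g) := h.powerBasis.lift_gen _ hmin
  have haeval (τ : CyclotomicFunctionField P Ω ≃ₐ[RatFunc F] CyclotomicFunctionField P Ω)
      (y : CyclotomicFunctionField P Ω) (f : F[X][X]) : τ (aeval y f) = aeval (τ y) f :=
    (aeval_algHom_apply ((τ : CyclotomicFunctionField P Ω →ₐ[RatFunc F]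
      CyclotomicFunctionField P Ω).restrictScalars F[X]) y f).symm
  have hσpow (i : ℕ) : (σ ^ i) hlam.gen = aeval hlam.gen (carlitzPoly (g ^ i)) := by
    induction i with
    | zero => simp [carlitzPoly_one]
    | succ i ih =>
      rw [pow_succ', AlgEquiv.mul_apply, ih, haeval, hσ, ← aeval_carlitzPoly_mul, pow_succ]
  refine ⟨σ, hσ, fun τ ↦ ?_⟩
  have hτ : aeval (τ hlam.gen) (carlitzPoly P) = 0 := by
    rw [← haeval, hlam.aeval_gen, map_zero]
  obtain ⟨a, ha⟩ := hlam.exists_eq_aeval_gen hτ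
  have haP : Ideal.Quotient.mk (Ideal.span {P}) a ≠ 0 := by
    rw [Ne, Ideal.Quotient.eq_zero_iff_mem, Ideal.mem_span_singleton]
    intro hdvd
    have h2 := aeval_carlitzPoly_eq_of_dvd_sub hlam.aeval_gen
      (a := a) (b := 0) (by rwa [sub_zero])
    rw [← ha, carlitzPoly_zero, map_zero, EmbeddingLike.map_eq_zero_iff] at h2
    exact h.ne_zero h2
  have hmax : (Ideal.span {P}).IsMaximal :=
    PrincipalIdealRing.isMaximal_of_irreducible hP.irreducible
  let := Ideal.Quotient.field (Ideal.span {P})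
  obtain ⟨i, hi⟩ := (isOfFinOrder_of_finite u).mem_powers_iff_mem_zpowers.2
    (hgen haP.isUnit.unit)
  have hdvd : P ∣ a - g ^ i := by
    rw [← Ideal.mem_span_singleton, ← Ideal.Quotient.eq, map_pow, ← hu, ← Units.val_pow_eq_pow_val]
    exact (congrArg Units.val hi).symm
  refine ⟨i, ?_⟩
  dsimp only
  rw [zpow_natCast]
  apply AlgEquiv.coe_toAlgHom_injective
  apply h.powerBasis.algHom_ext
  rw [h.powerBasis_gen]
  change (σ ^ i) hlam.gen = τ hlam.gen
  rw [hσpow, ha, aeval_carlitzPoly_eq_of_dvd_sub hlam.aeval_gen hdvd]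

theorem isCyclotomicUnit_coe_iff {y : CyclotomicFunctionField P Ω} :
    IsCyclotomicUnit P (y : Ω) ↔ IsIntegralUnit F[X] y := by
  constructor
  · rintro ⟨u, hu⟩
    obtain rfl : ((u : CyclotomicIntegers P Ω) : CyclotomicFunctionField P Ω) = y := Subtype.ext hu
    have h1 : ((u : CyclotomicIntegers P Ω) : CyclotomicFunctionField P Ω) *
        ((↑u⁻¹ : CyclotomicIntegers P Ω) : CyclotomicFunctionField P Ω) = 1 :=
      congrArg Subtype.val u.mul_inv
    refine ⟨left_ne_zero_of_mul_eq_one h1, Subtype.property _, ?_⟩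
    rw [inv_eq_of_mul_eq_one_right h1]
    exact Subtype.property _
  · rintro ⟨h0, h1, h2⟩
    exact ⟨⟨⟨y, h1⟩, ⟨y⁻¹, h2⟩, Subtype.ext (mul_inv_cancel₀ h0),
      Subtype.ext (inv_mul_cancel₀ h0)⟩, rfl⟩

/-- The representations of an element of the cyclotomic function field, in terms of the
automorphism `σ : λ ↦ C_g(λ)`. -/
theorem IsPrimitiveCarlitzRoot.isUnitRepresentation_iff (hP : Prime P) (hm : P.Monic)
    {lam : Ω} (hlam : IsPrimitiveCarlitzRoot P lam) {g : F[X]}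
    {σ : CyclotomicFunctionField P Ω ≃ₐ[RatFunc F] CyclotomicFunctionField P Ω}
    (hσ : σ hlam.gen = aeval hlam.gen (carlitzPoly g)) (ε : CyclotomicFunctionField P Ω) (l : ℕ)
    (Q : F[X][X]) :
    IsUnitRepresentation P g lam (ε : Ω) l Q ↔
      l < (carlitzEisenstein P).natDegree ∧ Q.natDegree < (carlitzEisenstein P).natDegree ∧
        IsIntegralUnit F[X] (aeval hlam.gen Q) ∧
        ε = (hlam.gen / σ hlam.gen) ^ l * (aeval hlam.gen Q / σ (aeval hlam.gen Q)) := by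
  have hcard : 1 < Fintype.card F ^ P.natDegree :=
    Nat.one_lt_pow hP.irreducible.natDegree_pos.ne' Fintype.one_lt_card
  have haeval : σ (aeval hlam.gen Q) = aeval (σ hlam.gen) Q :=
    (aeval_algHom_apply ((σ : CyclotomicFunctionField P Ω →ₐ[RatFunc F]
      CyclotomicFunctionField P Ω).restrictScalars F[X]) hlam.gen Q).symm
  have hlt (m : ℕ) : m < Fintype.card F ^ P.natDegree - 1 ↔
      m ≤ Fintype.card F ^ P.natDegree - 2 := by
    omega
  rw [natDegree_carlitzEisenstein hm, hlt, hlt, ← isCyclotomicUnit_coe_iff, haeval, hσ,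
    ← Subtype.coe_injective.eq_iff]
  simp only [IntermediateField.coe_mul, IntermediateField.coe_div, IntermediateField.coe_pow,
    coe_aeval_intermediateField]
  rfl

end cyclotomic

theorem mainTheorem1 {F : Type*} [Field F] [Fintype F]
    {Ω : Type*} [Field Ω] [Algebra F[X] Ω] [Algebra (RatFunc F) Ω]
    [IsScalarTower F[X] (RatFunc F) Ω] [IsAlgClosure (RatFunc F) Ω]
    (P : F[X]) (hP : Prime P) (hmonic : P.Monic)
    (hstar : 2 < Fintype.card F ∨ 1 < P.natDegree)
    (g : F[X]) (hg : IsPrimitiveRootModulo P g)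
    (lam : Ω) (hlam : IsPrimitiveCarlitzRoot P lam)
    (ε : (CyclotomicIntegers P Ω)ˣ)
    (hε : Algebra.norm (RatFunc F)
      ((ε : CyclotomicIntegers P Ω) : CyclotomicFunctionField P Ω) = 1) :
    ∃ (l : ℕ) (Q : F[X][X]),
      IsUnitRepresentation P g lam
          (((ε : CyclotomicIntegers P Ω) : CyclotomicFunctionField P Ω) : Ω) l Q ∧
        ∀ (l' : ℕ) (Q' : F[X][X]),
          IsUnitRepresentation P g lam
              (((ε : CyclotomicIntegers P Ω) : CyclotomicFunctionField P Ω) : Ω) l' Q' →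
            l' = l ∧ ∃ v : Fˣ, Q' = C (C (v : F)) * Q := by
  have : IsAlgClosed Ω := IsAlgClosure.isAlgClosed (RatFunc F)
  have : IsGalois (RatFunc F) (CyclotomicFunctionField P Ω) :=
    CyclotomicFunctionField.isGalois hP hmonic
  obtain ⟨σ, hσ, hgen⟩ := hlam.exists_galois_generator hP hmonic hg
  have h := hlam.isEisensteinGenerator hP hmonic
  have hiff := hlam.isUnitRepresentation_iff hP hmonic hσ
    ((ε : CyclotomicIntegers P Ω) : CyclotomicFunctionField P Ω)
  obtain ⟨l, Q, hl, hQ, hQu, e⟩ := h.exists_unit_representation hgen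
    (isCyclotomicUnit_coe_iff.1 ⟨ε, rfl⟩) hε
  refine ⟨l, Q, (hiff l Q).2 ⟨hl, hQ, hQu, e⟩, fun l' Q' h' ↦ ?_⟩
  obtain ⟨hl', hQ', hQu', e'⟩ := (hiff l' Q').1 h'
  obtain ⟨rfl, v, hv⟩ := h.unit_representation_unique hgen hl hl' hQ hQ' hQu hQu' (e.symm.trans e')
  obtain ⟨c, hc, hcv⟩ := Polynomial.isUnit_iff.1 v.isUnit
  exact ⟨rfl, hc.unit, by rw [hv, ← hcv, IsUnit.unit_spec]⟩
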